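/- Let $S$ be a quasi-compact scheme and let $S_{\mathrm{pro\acute{e}t}}$ be its pro-étale site: the category of schemes weakly étale over $S$, where a morphism $X \to Y$ is called a covering if every affine open of $Y$ is a finite union of images of affine opens of $X$. A hypercovering of $S$ is a simplicial object $U_\bullet$ of $S_{\mathrm{pro\acute{e}t}}$ such that $U_0 \to S$ and the canonical morphisms $U_{n+1} \to \mathrm{cosk}_n(U_\bullet)_{n+1}$, $n \ge 0$, are coverings. An object $W$ of $S_{\mathrm{pro\acute{e}t}}$ is weakly contractible (wc) if evaluation at $W$ sends surjections of sheaves of sets to surjections of sets. A simplicial object $W_\bullet$ is affine (wc) if every $W_n$ is affine (wc), and split if there are subobjects $N_m$ of $W_m$ (the non-degenerate simplices) such that for each $n$ the canonical morphism from the disjoint union of the $N_m$ over all surjections $[n] \twoheadrightarrow [m]$ to $W_n$ is an isomorphism. **Theorem.** Let $W_\bullet$ be a split affine wc hypercovering of $S$ and let $U_\bullet$ be any hypercovering of $S$. Then there exists a morphism $W_\bullet \to U_\bullet$ of simplicial objects of $S_{\mathrm{pro\acute{e}t}}$, and it is unique up to simplicial homotopy: for any two morphisms $f, g \colon W_\bullet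 \to U_\bullet$ there is a simplicial homotopy from $f$ to $g$. -/

import Mathlib

open CategoryTheory Limits Opposite AlgebraicGeometry
open scoped Simplicial

universe u

namespace ProetHypercovering

/-! ### Existence of coskeleta in categories with finite limits -/

instance finite_truncated (n : ℕ) : Finite (SimplexCategory.Truncated n) :=
  Finite.of_injective
    (fun a : SimplexCategory.Truncated n => (⟨a.obj.len, Nat.lt_succ_of_le a.property⟩ : Fin (n + 1)))
    (by
      rintro ⟨a, ha⟩ ⟨b, hb⟩ h
      have h' : a = b := SimplexCategory.ext (by simpa using h)
      subst h'
      rfl)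

instance finite_structuredArrow_obj (n : ℕ) (Y : SimplexCategoryᵒᵖ) :
    Finite (StructuredArrow Y (SimplexCategory.Truncated.inclusion n).op) := by
  have hhom : ∀ b : (SimplexCategory.Truncated n)ᵒᵖ,
      Finite (Y ⟶ (SimplexCategory.Truncated.inclusion n).op.obj b) := fun b =>
    Finite.of_injective (fun f => f.unop) Quiver.Hom.unop_inj
  have hop : Finite (SimplexCategory.Truncated n)ᵒᵖ := Finite.of_equiv _ equivToOpposite
  refine Finite.of_injective
    (β := Σ b : (SimplexCategory.Truncated n)ᵒᵖ,
      (Y ⟶ (SimplexCategory.Truncated.inclusion n).op.obj b))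
    (fun a => ⟨a.right, a.hom⟩) ?_
  rintro ⟨⟨⟨⟩⟩, b, f⟩ ⟨⟨⟨⟩⟩, b', f'⟩ h
  simp only [Sigma.mk.injEq] at h
  obtain ⟨rfl, h⟩ := h
  obtain rfl := eq_of_heq h
  rfl

instance finite_structuredArrow_hom (n : ℕ) (Y : SimplexCategoryᵒᵖ)
    (a b : StructuredArrow Y (SimplexCategory.Truncated.inclusion n).op) : Finite (a ⟶ b) := by
  refine Finite.of_injective
    (β := (b.right.unop.obj ⟶ a.right.unop.obj)) (fun f => f.right.unop.hom) ?_
  intro f g h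
  apply StructuredArrow.ext
  apply Quiver.Hom.unop_inj
  exact ObjectProperty.hom_ext _ h

noncomputable instance finCategory_structuredArrow (n : ℕ) (Y : SimplexCategoryᵒᵖ) :
    FinCategory (StructuredArrow Y (SimplexCategory.Truncated.inclusion n).op) where
  fintypeObj := Fintype.ofFinite _
  fintypeHom _ _ := Fintype.ofFinite _

instance hasRightKanExtension_truncated {C : Type*} [Category C] [HasFiniteLimits C] (n : ℕ)
    (F : (SimplexCategory.Truncated n)ᵒᵖ ⥤ C) :
    (SimplexCategory.Truncated.inclusion n).op.HasRightKanExtension F := by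
  have : (SimplexCategory.Truncated.inclusion n).op.HasPointwiseRightKanExtension F := fun Y =>
    inferInstanceAs (HasLimit (StructuredArrow.proj Y _ ⋙ F))
  infer_instance

/-! ### Hypercoverings in the pro-étale site -/

variable {S : Scheme.{u}}

/-- A morphism `f : X ⟶ Y` of the pro-étale site of `S` is a covering if the one-element family
`{f}` is a covering family of that site: every affine open of `Y` is a finite union of
images of quasi-compact opens (equivalently, of affine opens) of `X`. -/
def IsCovering {X Y : S.ProEt} (f : X ⟶ Y) : Prop :=
  Presieve.singleton f ∈ Scheme.ProEt.precoverage S Y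

/-- The structure morphism of `X`, as a morphism to the final object `S` of the
pro-étale site of `S`. -/
def toBase (X : S.ProEt) : X ⟶ Scheme.ProEt.mk (𝟙 S) :=
  MorphismProperty.Over.homMk X.hom

/-- A hypercovering of `S`: a simplicial object `U` of the pro-étale site such that `U₀ ⟶ S` and
all the canonical morphisms `Uₙ₊₁ ⟶ (coskₙ U)ₙ₊₁` are coverings. -/
structure IsHypercovering (U : SimplicialObject S.ProEt) : Prop where
  zero : IsCovering (toBase (U _⦋0⦌))
  succ (n : ℕ) : IsCovering (((SimplicialObject.coskAdj n).unit.app U).app (op ⦋n + 1⦌))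

/-- An object `W` of the pro-étale site is weakly contractible if evaluation at `W` sends
surjections of sheaves of sets (i.e. locally surjective morphisms) to surjections of sets. -/
def IsWeaklyContractible (W : S.ProEt) : Prop :=
  ∀ (F G : Sheaf (Scheme.ProEt.topology S) (Type u)) (φ : F ⟶ G),
    Sheaf.IsLocallySurjective φ → Function.Surjective (φ.hom.app (op W))

/-- A simplicial object of the pro-étale site is affine if all its terms are affine schemes. -/
def IsAffineSimplicial (W : SimplicialObject S.ProEt) : Prop :=
  ∀ n : ℕ, IsAffine (W _⦋n⦌).left

/-- A simplicial object of the pro-étale site is wc if all its terms are weakly contractible. -/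
def IsWeaklyContractibleSimplicial (W : SimplicialObject S.ProEt) : Prop :=
  ∀ n : ℕ, IsWeaklyContractible (W _⦋n⦌)

/-- A simplicial object `W` is split if there are subobjects `Nₘ` of `Wₘ` (the non-degenerate
simplices) such that each `Wₙ` is the coproduct of the `Nₘ` over all surjections `[n] ↠ [m]`. -/
def IsSplit (W : SimplicialObject S.ProEt) : Prop :=
  Nonempty (SimplicialObject.Splitting W)

/-- Two morphisms of simplicial objects are (simplicially) homotopic if there is a simplicial
homotopy from the first to the second. -/
def Homotopic {X Y : SimplicialObject S.ProEt} (f g : X ⟶ Y) : Prop :=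
  Nonempty (SimplicialObject.Homotopy f g)

end ProetHypercovering

/-!
Why the theorem is true. If `T` is weakly contractible and `X ⟶ Y` is a covering, every morphism
`T ⟶ Y` lifts to `X`, because the covering becomes a surjection of representable sheaves
(`IsWeaklyContractible.exists_lift`). Applied to the maps from a hypercovering `U` to its coskeleta,
this says that the simplicial set `Hom(T, U)` has the right lifting property with respect to the
inclusions `∂Δ[n] ⟶ Δ[n]` (`IsWeaklyContractible.hasFillers`).

Let now `W` be split with weakly contractible terms. The existence of a morphism `W ⟶ U` and of a
homotopy between two such morphisms are both cases of one extension property: a morphism to `U`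
given on the product of `W` with a simplicial subset `B` of a standard simplex `X` extends to the
product of `W` with `X` (`Splitting.exists_extension`). The inclusion of the empty set into a point
gives the morphism, that of the two endpoints into `Δ[1]` gives the homotopy.

The extension is built by induction on the dimension `n`. Fix an `n`-simplex `a` of `X` outside
`B`, and a summand of `W _⦋n⦌`, indexed by a surjection `p` from `⦋n⦌`. If `p` and `a` have a common
degeneracy, the value on the summand is forced. Otherwise it may be any filler of the boundary given
by the lower dimensional values; such a filler exists over the whole of `W _⦋n⦌`, and is restricted
to the summand (`exists_hom_on_summand`). The forced values are consistent because a pair `(p, a)`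
has a maximal common degeneracy
(`SimplexCategory.exists_maximal_common_factorization`).
-/

/-! ### Dependent recursion with a binary compatibility condition -/

/-- A family `x n : D n` whose members are pairwise related by `Q` can be built recursively, as soon
as every such family on `{m | m < n}` can be prolonged to `n`. The values `x n` may depend on the
relations satisfied by the previous ones, so that recursion has to carry these relations along. -/
theorem exists_forall_rel_of_step {D : ℕ → Type*} (Q : ∀ m n, D m → D n → Prop)
    (step : ∀ (n : ℕ) (x : ∀ m < n, D m),
      (∀ m hm m' hm', Q m m' (x m hm) (x m' hm')) →
      ∃ y : D n, (∀ m hm, Q m n (x m hm) y ∧ Q n m y (x m hm)) ∧ Q n n y y) :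
    ∃ x : ∀ n, D n, ∀ m n, Q m n (x m) (x n) := by
  let P (n : ℕ) := {x : ∀ m < n, D m // ∀ m hm m' hm', Q m m' (x m hm) (x m' hm')}
  have ext (n : ℕ) (x : P n) : ∃ y : P (n + 1), ∀ m (hm : m < n), y.1 m (by lia) = x.1 m hm := by
    obtain ⟨y, hy, hyy⟩ := step n x.1 x.2
    refine ⟨⟨fun m hm => if h : m < n then x.1 m h else
      (show m = n by lia) ▸ y, fun m hm m' hm' => ?_⟩, fun m hm => dif_pos hm⟩
    obtain h | rfl := Nat.lt_succ_iff_lt_or_eq.mp hm <;>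
    obtain h' | rfl := Nat.lt_succ_iff_lt_or_eq.mp hm'
    · simpa [h, h'] using x.2 m h m' h'
    · simpa [h] using (hy m h).1
    · simpa [h'] using (hy m' h').2
    · simpa using hyy
  choose next hnext using ext
  -- `seq n` is the family on `{m | m < n}` obtained after `n` steps; these families agree.
  let seq (n : ℕ) : P n := Nat.rec ⟨fun m hm => absurd hm (by lia), fun m hm => absurd hm (by lia)⟩
    next n
  have coh (m n : ℕ) (h : m < n) : (seq n).1 m h = (seq (m + 1)).1 m (Nat.lt_succ_self m) := by
    induction n, h using Nat.le_induction with
    | base => rfl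
    | succ n h ih => exact (hnext n (seq n) m h).trans ih
  refine ⟨fun n => (seq (n + 1)).1 n (Nat.lt_succ_self n), fun m n => ?_⟩
  have := (seq (m + n + 1)).2 m (by lia) n (by lia)
  rwa [coh m (m + n + 1), coh n (m + n + 1)] at this

/-! ### Common factorizations in the simplex category -/

namespace SimplexCategory

/-- If `s` and `a` identify the same pair of vertices, then both factor through one codegeneracy
`e`: being monotone, they also identify the smaller vertex with its successor. -/
theorem exists_common_factorization_of_not_injective {k : ℕ} {X Y : SimplexCategory}
    (s : ⦋k⦌ ⟶ X) (a : ⦋k⦌ ⟶ Y) {p q : Fin (k + 1)} (hpq : p ≠ q)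
    (hs : s.toOrderHom p = s.toOrderHom q) (ha : a.toOrderHom p = a.toOrderHom q) :
    ∃ (l : ℕ) (_ : l < k) (e : ⦋k⦌ ⟶ ⦋l⦌) (d : ⦋l⦌ ⟶ ⦋k⦌),
      e ≫ d ≫ s = s ∧ e ≫ d ≫ a = a := by
  wlog hlt : p < q generalizing p q
  · exact this hpq.symm hs.symm ha.symm (lt_of_le_of_ne (not_lt.mp hlt) hpq.symm)
  cases k with
  | zero => exact absurd (Subsingleton.elim (α := Fin 1) p q) hpq
  | succ l =>
    have key {Z : SimplexCategory} (f : ⦋l + 1⦌ ⟶ Z) (hf : f.toOrderHom p = f.toOrderHom q) :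
        SimplexCategory.σ (p.castPred (hlt.trans_le (Fin.le_last _)).ne) ≫
          SimplexCategory.δ (p.castPred (hlt.trans_le (Fin.le_last _)).ne).castSucc ≫ f = f := by
      obtain ⟨f', rfl⟩ := eq_σ_comp_of_not_injective' f
        (p.castPred (hlt.trans_le (Fin.le_last _)).ne) (by
          apply le_antisymm
          · exact f.toOrderHom.monotone Fin.castSucc_lt_succ.le
          · rw [Fin.castSucc_castPred, hf]
            exact f.toOrderHom.monotone ((Fin.succ_castPred_le_iff _).mpr hlt))
      rw [δ_comp_σ_self_assoc]
    exact ⟨l, l.lt_succ_self, _, _, key s hs, key a ha⟩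

theorem exists_split_factorization_of_not_mono {n : ℕ} {Δ : SimplexCategory} (θ : ⦋n⦌ ⟶ Δ)
    (hθ : ¬ Mono θ) :
    ∃ (k : ℕ) (_ : k < n) (e : ⦋n⦌ ⟶ ⦋k⦌) (i : ⦋k⦌ ⟶ Δ) (d : ⦋k⦌ ⟶ ⦋n⦌),
      d ≫ e = 𝟙 _ ∧ e ≫ i = θ := by
  rw [mono_iff_injective] at hθ
  cases n with
  | zero => exact absurd (Function.injective_of_subsingleton (α := Fin 1) _) hθ
  | succ l =>
    obtain ⟨i, θ', rfl⟩ := eq_σ_comp_of_not_injective θ hθ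
    exact ⟨l, l.lt_succ_self, σ i, θ', δ i.castSucc, δ_comp_σ_self, rfl⟩

/-- If `s` and `a` both factor through some `⦋k⦌` with `k < n`, they do so through a maximal common
degeneracy `e`: one that absorbs every endomorphism `c` fixing both `s` and `a`. This is the
existence and uniqueness of the Eilenberg–Zilber decomposition of the simplex `(s, a)` of the
product of the standard simplices `X` and `Y`. -/
theorem exists_maximal_common_factorization {n : ℕ} {X Y : SimplexCategory}
    (s : ⦋n⦌ ⟶ X) (a : ⦋n⦌ ⟶ Y)
    (h : ∃ (k : ℕ) (_ : k < n) (e : ⦋n⦌ ⟶ ⦋k⦌) (d : ⦋k⦌ ⟶ ⦋n⦌),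
      e ≫ d ≫ s = s ∧ e ≫ d ≫ a = a) :
    ∃ (k : ℕ) (_ : k < n) (e : ⦋n⦌ ⟶ ⦋k⦌) (d : ⦋k⦌ ⟶ ⦋n⦌),
      e ≫ d ≫ s = s ∧ e ≫ d ≫ a = a ∧ ∀ c : ⦋n⦌ ⟶ ⦋n⦌, c ≫ s = s → c ≫ a = a → c ≫ e = e := by
  classical
  -- For the least possible `k`, the pair `(d ≫ s, d ≫ a)` is injective on vertices.
  obtain ⟨hk, e, d, hs, ha⟩ := Nat.find_spec h
  refine ⟨Nat.find h, hk, e, d, hs, ha, fun c hcs hca => ?_⟩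
  ext i : 3
  by_contra hne
  have aux {Z : SimplexCategory} (f : ⦋n⦌ ⟶ Z) (hf : e ≫ d ≫ f = f) (hcf : c ≫ f = f) :
      (d ≫ f).toOrderHom ((c ≫ e).toOrderHom i) = (d ≫ f).toOrderHom (e.toOrderHom i) := by
    have : (c ≫ e) ≫ d ≫ f = e ≫ d ≫ f := by rw [Category.assoc, hf, hcf]
    exact congrArg (fun g => g.toOrderHom i) this
  obtain ⟨l, hl, e', d', hs', ha'⟩ :=
    exists_common_factorization_of_not_injective (d ≫ s) (d ≫ a) hne
      (aux s hs hcs) (aux a ha hca)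
  refine Nat.find_min h hl ⟨hl.trans hk, e ≫ e', d' ≫ d, ?_, ?_⟩
  · simpa [hs] using e ≫= hs'
  · simpa [ha] using e ≫= ha'

/-- The map `⦋n⦌ ⟶ ⦋1⦌` sending the first `k` vertices `0, …, k - 1` to `0` and the others to `1`.
It is constant for `k = 0` and for `n < k`. -/
def threshold (n k : ℕ) : ⦋n⦌ ⟶ ⦋1⦌ :=
  SimplexCategory.mkHom ⟨fun j => if j.val < k then 0 else 1, fun i j hij => by
    have : i.val ≤ j.val := hij
    dsimp only
    split_ifs
    · exact le_rfl
    · exact Fin.zero_le _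
    · lia
    · exact le_rfl⟩

theorem threshold_apply (n k : ℕ) (j : Fin (n + 1)) :
    (threshold n k).toOrderHom j = if j.val < k then 0 else 1 := rfl

theorem δ_comp_threshold {n : ℕ} (i : Fin (n + 2)) {k l : ℕ}
    (h : i.val < k ∧ k = l + 1 ∨ k ≤ i.val ∧ k = l) :
    δ i ≫ threshold (n + 1) k = threshold n l := by
  ext j : 3
  change (threshold (n + 1) k).toOrderHom (i.succAbove j) = _
  rw [threshold_apply, threshold_apply]
  congr 1
  rw [Fin.succAbove]
  split_ifs with h' <;> simp [Fin.lt_def] at h' ⊢ <;> lia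

theorem σ_comp_threshold {n : ℕ} (i : Fin (n + 1)) {k l : ℕ}
    (h : i.val < k ∧ l = k + 1 ∨ k ≤ i.val ∧ k = l) :
    σ i ≫ threshold n k = threshold (n + 1) l := by
  ext j : 3
  change (threshold n k).toOrderHom (i.predAbove j) = _
  rw [threshold_apply, threshold_apply]
  congr 1
  rw [Fin.predAbove]
  split_ifs with h' <;> simp [Fin.lt_def] at h' ⊢ <;> lia

end SimplexCategory

/-! ### Filling boundaries -/

namespace CategoryTheory.SimplicialObject

variable {C : Type*} [Category C]

/-- `U` has fillers over `T` if the simplicial set `Hom(T, U)` has the right lifting property with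
respect to the boundary inclusions `∂Δ[n] ⟶ Δ[n]` for all `n ≥ 0`. The boundary of a simplex is
encoded as a compatible family `x` indexed by all the maps `Δ ⟶ ⦋n⦌` with `Δ` of dimension less
than `n`, so that for `n = 0` the condition says that there is a morphism `T ⟶ U _⦋0⦌`. -/
def HasFillers (T : C) (U : SimplicialObject C) : Prop :=
  ∀ (n : ℕ) (x : ∀ Δ : SimplexCategory, Δ.len < n → (Δ ⟶ ⦋n⦌) → (T ⟶ U.obj (op Δ))),
    (∀ (Δ Δ' : SimplexCategory) (hΔ : Δ.len < n) (hΔ' : Δ'.len < n) (η : Δ' ⟶ Δ) (θ : Δ ⟶ ⦋n⦌),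
      x Δ' hΔ' (η ≫ θ) = x Δ hΔ θ ≫ U.map η.op) →
    ∃ z : T ⟶ U _⦋n⦌, ∀ (Δ : SimplexCategory) (hΔ : Δ.len < n) (θ : Δ ⟶ ⦋n⦌),
      z ≫ U.map θ.op = x Δ hΔ θ

/-- The object of `(n + 1)`-simplices of the `n`-coskeleton of `U` is the limit of the objects
`U.obj (op Δ)` over the maps `Δ ⟶ ⦋n + 1⦌` with `Δ` of dimension at most `n`, hence it represents
boundaries of `(n + 1)`-simplices of `U`. -/
theorem hasFillers_of_lifts [HasFiniteLimits C] (T : C) (U : SimplicialObject C)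
    (h₀ : Nonempty (T ⟶ U _⦋0⦌))
    (h : ∀ (n : ℕ) (y : T ⟶ ((SimplicialObject.cosk n).obj U) _⦋n + 1⦌),
      ∃ z : T ⟶ U _⦋n + 1⦌,
        z ≫ ((SimplicialObject.coskAdj n).unit.app U).app (op ⦋n + 1⦌) = y) :
    HasFillers T U := by
  intro n x hx
  cases n with
  | zero => exact ⟨h₀.some, fun Δ hΔ => absurd hΔ (by lia)⟩
  | succ n =>
    let L := (SimplexCategory.Truncated.inclusion n).op
    have hpw : L.HasPointwiseRightKanExtension (L ⋙ U) := fun Y =>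
      inferInstanceAs (HasLimit (StructuredArrow.proj Y _ ⋙ (L ⋙ U)))
    let hlim := L.isPointwiseRightKanExtensionRanCounit (L ⋙ U) (op ⦋n + 1⦌)
    let c : Cone (StructuredArrow.proj (op ⦋n + 1⦌) L ⋙ L ⋙ U) :=
      { pt := T
        π :=
          { app A := x A.right.unop.obj (Nat.lt_succ_of_le A.right.unop.property) A.hom.unop
            naturality A B f := by
              have hw : A.hom ≫ L.map f.right = B.hom := StructuredArrow.w f
              have := hx A.right.unop.obj B.right.unop.obj
                (Nat.lt_succ_of_le A.right.unop.property) (Nat.lt_succ_of_le B.right.unop.property)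
                (L.map f.right).unop A.hom.unop
              rw [← unop_comp, hw] at this
              refine (Category.id_comp _).trans this } }
    obtain ⟨z, hz⟩ := h n (hlim.lift c)
    refine ⟨z, fun Δ hΔ θ => ?_⟩
    let A : StructuredArrow (op ⦋n + 1⦌) L :=
      StructuredArrow.mk (Y := op (⟨Δ, Nat.le_of_lt_succ hΔ⟩ : SimplexCategory.Truncated n)) θ.op
    -- The counit undoes the unit in dimensions at most `n` (`h₂`), so the restriction of `z` along
    -- `θ` is the projection indexed by `θ` of the composition of `z` with the unit.
    have h₁ := hlim.fac c A
    have h₂ := L.ranCounit_app_app_ranAdjunction_unit_app_app U A.right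
    have h₃ := ((SimplicialObject.coskAdj n).unit.app U).naturality θ.op
    have h₄ := ((Category.assoc _ _ _).symm.trans (congrArg (· ≫ _) hz)).trans h₁
    have h₅ := (congrArg (z ≫ ·) ((Category.assoc _ _ _).symm.trans
      ((congrArg (· ≫ (L.ranCounit.app (L ⋙ U)).app A.right) h₃).trans
        (Category.assoc _ _ _)))).trans h₄
    exact ((congrArg (fun t => z ≫ U.map θ.op ≫ t) h₂).trans
      (congrArg (z ≫ ·) (Category.comp_id _))).symm.trans h₅

/-! ### Extension of morphisms along a split simplicial object -/

theorem Splitting.hom_ext_of_epi {W : SimplicialObject C} (s : Splitting W) {n : ℕ} {Z : C}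
    {f g : W _⦋n⦌ ⟶ Z}
    (h : ∀ (m : ℕ) (e : ⦋n⦌ ⟶ ⦋m⦌), Epi e → s.ι m ≫ W.map e.op ≫ f = s.ι m ≫ W.map e.op ≫ g) :
    f = g :=
  s.hom_ext' f g fun A => (Category.assoc _ _ _).trans
    ((h A.1.unop.len A.e inferInstance).trans (Category.assoc _ _ _).symm)

theorem Splitting.exists_desc {W : SimplicialObject C} (s : Splitting W) {n : ℕ} {Z : C}
    (F : ∀ m : ℕ, (⦋n⦌ ⟶ ⦋m⦌) → (s.N m ⟶ Z)) :
    ∃ f : W _⦋n⦌ ⟶ Z, ∀ (m : ℕ) (e : ⦋n⦌ ⟶ ⦋m⦌), Epi e → s.ι m ≫ W.map e.op ≫ f = F m e :=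
  ⟨s.desc (op ⦋n⦌) fun A => F A.1.unop.len A.e, fun m e _ =>
    (Category.assoc _ _ _).symm.trans (s.ι_desc (op ⦋n⦌) _ (Splitting.IndexSet.mk e))⟩

/-- The value of the extended family at `a : ⦋n⦌ ⟶ X` on the summand of `W _⦋n⦌` indexed by
`p : ⦋n⦌ ⟶ ⦋l⦌`. If the simplex `(p, a)` of `Δ[l] × X` is degenerate, the value is forced by the
lower dimensional ones, and maximality of the chosen common degeneracy makes it compatible with all
other degeneracies; otherwise the value is the restriction of a filler defined on all of `W _⦋n⦌`.
In particular, nothing has to be known about the object `N` of nondegenerate simplices. -/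
theorem exists_hom_on_summand {W U : SimplicialObject C} {X : SimplexCategory} {n : ℕ}
    (φ : ∀ m < n, (⦋m⦌ ⟶ X) → (W _⦋m⦌ ⟶ U _⦋m⦌))
    (hφ : ∀ m hm m' hm' (θ : ⦋m⦌ ⟶ ⦋m'⦌) (a : ⦋m'⦌ ⟶ X),
      W.map θ.op ≫ φ m hm (θ ≫ a) = φ m' hm' a ≫ U.map θ.op)
    (hfill : HasFillers (W _⦋n⦌) U) {N : C} {l : ℕ} (ι : N ⟶ W _⦋l⦌)
    (a : ⦋n⦌ ⟶ X) (p : ⦋n⦌ ⟶ ⦋l⦌) :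
    ∃ y : N ⟶ U _⦋n⦌,
      (∀ m (hm : m < n) (θ : ⦋m⦌ ⟶ ⦋n⦌),
        y ≫ U.map θ.op = ι ≫ W.map p.op ≫ W.map θ.op ≫ φ m hm (θ ≫ a)) ∧
      ∀ m (hm : m < n) (θ : ⦋n⦌ ⟶ ⦋m⦌) (b : ⦋m⦌ ⟶ X) (t : ⦋m⦌ ⟶ ⦋l⦌) (d : ⦋m⦌ ⟶ ⦋n⦌),
        d ≫ θ = 𝟙 _ → θ ≫ b = a → θ ≫ t = p →
        y = ι ≫ W.map t.op ≫ φ m hm b ≫ U.map θ.op := by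
  by_cases h : ∃ (k : ℕ) (_ : k < n) (e : ⦋n⦌ ⟶ ⦋k⦌) (d : ⦋k⦌ ⟶ ⦋n⦌),
      e ≫ d ≫ p = p ∧ e ≫ d ≫ a = a
  · obtain ⟨k, hk, e, d, hs, ha, hmax⟩ :=
      SimplexCategory.exists_maximal_common_factorization p a h
    refine ⟨ι ≫ W.map (d ≫ p).op ≫ φ k hk (d ≫ a) ≫ U.map e.op, ?_, ?_⟩
    · intro m hm θ
      have := hφ m hm k hk (θ ≫ e) (d ≫ a)
      simp only [Category.assoc, ha] at this
      rw [Category.assoc, Category.assoc, Category.assoc, ← U.map_comp, ← op_comp, ← this,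
        ← W.map_comp_assoc, ← W.map_comp_assoc, ← op_comp, ← op_comp, Category.assoc, hs]
    · intro m hm θ b t d₀ hd hb ht
      have hc : (θ ≫ d₀) ≫ e = e := hmax _
        (by rw [← ht, Category.assoc, reassoc_of% hd])
        (by rw [← hb, Category.assoc, reassoc_of% hd])
      have hba : (d₀ ≫ e) ≫ d ≫ a = b := by
        rw [Category.assoc, ha, ← hb, reassoc_of% hd]
      have hts : (d₀ ≫ e) ≫ d ≫ p = t := by
        rw [Category.assoc, hs, ← ht, reassoc_of% hd]
      have := hφ m hm k hk (d₀ ≫ e) (d ≫ a)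
      rw [hba] at this
      have he : U.map e.op = U.map (d₀ ≫ e).op ≫ U.map θ.op := by
        rw [← U.map_comp, ← op_comp, ← Category.assoc, hc]
      rw [he, ← reassoc_of% this, ← hts, op_comp (f := d₀ ≫ e), W.map_comp_assoc]
  · -- In a boundary indexed by objects `Δ`, the family `φ` is used at `⦋Δ.len⦌`, which is `Δ`
    -- by definition.
    obtain ⟨z, hz⟩ := hfill n
      (fun Δ hΔ θ => W.map θ.op ≫ φ Δ.len hΔ (θ ≫ a)) (fun Δ Δ' hΔ hΔ' η θ => by
        have := hφ Δ'.len hΔ' Δ.len hΔ η (θ ≫ a)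
        refine Eq.trans ?_ ((W.map θ.op ≫= this).trans (Category.assoc _ _ _).symm)
        rw [op_comp, W.map_comp_assoc, Category.assoc])
    refine ⟨ι ≫ W.map p.op ≫ z, fun m hm θ => ?_, fun m hm θ b t d hd hb ht => ?_⟩
    · rw [Category.assoc, Category.assoc, hz ⦋m⦌ hm θ]
    · refine absurd ⟨m, hm, θ, d, ?_, ?_⟩ h
      · rw [← ht, reassoc_of% hd]
      · rw [← hb, reassoc_of% hd]

/-- Let `W` be split, and let `U` have fillers over all the terms of `W`. A morphism to `U` defined
on the product of `W` with a simplicial subset `B` of the standard simplex `X` extends to the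
product of `W` with `X`. Here a morphism from the product of `W` with a simplicial set `K` to `U` is
encoded as a family of morphisms `W _⦋n⦌ ⟶ U _⦋n⦌` indexed by the `n`-simplices of `K` for all `n`,
subject to naturality in `n`; this makes sense without any assumption on the category. -/
theorem Splitting.exists_extension {W U : SimplicialObject C} (s : Splitting W)
    (hfill : ∀ n : ℕ, HasFillers (W _⦋n⦌) U) (X : SimplexCategory)
    (B : ∀ {n : ℕ}, (⦋n⦌ ⟶ X) → Prop)
    (hB : ∀ {m n : ℕ} (θ : ⦋m⦌ ⟶ ⦋n⦌) (a : ⦋n⦌ ⟶ X), B a → B (θ ≫ a))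
    (β : ∀ {n : ℕ} (a : ⦋n⦌ ⟶ X), B a → (W _⦋n⦌ ⟶ U _⦋n⦌))
    (hβ : ∀ {m n : ℕ} (θ : ⦋m⦌ ⟶ ⦋n⦌) (a : ⦋n⦌ ⟶ X) (ha : B a),
      W.map θ.op ≫ β (θ ≫ a) (hB θ a ha) = β a ha ≫ U.map θ.op) :
    ∃ φ : ∀ n : ℕ, (⦋n⦌ ⟶ X) → (W _⦋n⦌ ⟶ U _⦋n⦌),
      (∀ (m n : ℕ) (θ : ⦋m⦌ ⟶ ⦋n⦌) (a : ⦋n⦌ ⟶ X),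
        W.map θ.op ≫ φ m (θ ≫ a) = φ n a ≫ U.map θ.op) ∧
      ∀ (n : ℕ) (a : ⦋n⦌ ⟶ X) (ha : B a), φ n a = β a ha := by
  classical
  let D (n : ℕ) := ∀ a : ⦋n⦌ ⟶ X, {ψ : W _⦋n⦌ ⟶ U _⦋n⦌ // ∀ ha : B a, ψ = β a ha}
  suffices h : ∃ φ : ∀ n, D n, ∀ (m n : ℕ) (θ : ⦋m⦌ ⟶ ⦋n⦌) (a : ⦋n⦌ ⟶ X),
      W.map θ.op ≫ (φ m (θ ≫ a)).1 = (φ n a).1 ≫ U.map θ.op by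
    obtain ⟨φ, hφ⟩ := h
    exact ⟨fun n a => (φ n a).1, hφ, fun n a ha => (φ n a).2 ha⟩
  refine exists_forall_rel_of_step (D := D)
    (fun m n x y => ∀ (θ : ⦋m⦌ ⟶ ⦋n⦌) (a : ⦋n⦌ ⟶ X),
      W.map θ.op ≫ (x (θ ≫ a)).1 = (y a).1 ≫ U.map θ.op) ?_
  intro n φ hφ
  -- It is enough to achieve compatibility with the maps from lower dimensions and with the split
  -- epimorphisms to lower dimensions, since every other map except the identity factors through
  -- such maps.
  have hψ (a : ⦋n⦌ ⟶ X) : ∃ ψ : {ψ : W _⦋n⦌ ⟶ U _⦋n⦌ // ∀ ha : B a, ψ = β a ha},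
      (∀ m (hm : m < n) (θ : ⦋m⦌ ⟶ ⦋n⦌),
        W.map θ.op ≫ (φ m hm (θ ≫ a)).1 = ψ.1 ≫ U.map θ.op) ∧
      ∀ m (hm : m < n) (θ : ⦋n⦌ ⟶ ⦋m⦌) (b : ⦋m⦌ ⟶ X) (d : ⦋m⦌ ⟶ ⦋n⦌),
        d ≫ θ = 𝟙 _ → θ ≫ b = a → W.map θ.op ≫ ψ.1 = (φ m hm b).1 ≫ U.map θ.op := by
    by_cases ha : B a
    · refine ⟨⟨β a ha, fun _ => rfl⟩, fun m hm θ => ?_, fun m hm θ b d hd hb => ?_⟩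
      · rw [(φ m hm (θ ≫ a)).2 (hB θ a ha), hβ]
      · have hbB : B b := by
          have := hB d a ha
          rwa [← hb, reassoc_of% hd] at this
        subst hb
        rw [(φ m hm b).2 hbB, ← hβ]
    · have hy (l : ℕ) (p : ⦋n⦌ ⟶ ⦋l⦌) := exists_hom_on_summand
        (fun m hm a => (φ m hm a).1) hφ (hfill n) (s.ι l) a p
      choose y hy₁ hy₂ using hy
      obtain ⟨f, hf⟩ := s.exists_desc y
      refine ⟨⟨f, fun h => absurd h ha⟩, fun m hm θ => ?_, fun m hm θ b d hd hb => ?_⟩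
      · refine s.hom_ext_of_epi fun l p hp => ?_
        rw [reassoc_of% hf l p hp, hy₁ l p m hm θ]
      · refine s.hom_ext_of_epi fun l t ht => ?_
        have : IsSplitEpi θ := ⟨⟨d, hd⟩⟩
        rw [← W.map_comp_assoc, ← op_comp, hf l (θ ≫ t) (epi_comp _ _)]
        exact hy₂ l (θ ≫ t) m hm θ b t d hd hb rfl
  choose ψ hψ₁ hψ₂ using hψ
  refine ⟨ψ, fun m hm => ⟨fun θ a => hψ₁ a m hm θ, fun θ b => ?_⟩, fun θ a => ?_⟩
  · obtain ⟨k, hk, e, i, d, hd, rfl⟩ := SimplexCategory.exists_split_factorization_of_not_mono θ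
      fun _ => absurd (SimplexCategory.len_le_of_mono θ) (not_le.mpr hm)
    have := hφ k hk m hm i b
    rw [op_comp, W.map_comp, U.map_comp, Category.assoc,
      hψ₂ _ k hk e (i ≫ b) d hd (Category.assoc _ _ _).symm, ← reassoc_of% this]
  · by_cases hθ : Mono θ
    · obtain rfl := SimplexCategory.eq_id_of_mono θ
      rw [Category.id_comp, op_id, W.map_id, U.map_id, Category.id_comp, Category.comp_id]
    · obtain ⟨k, hk, e, i, d, hd, rfl⟩ :=
        SimplexCategory.exists_split_factorization_of_not_mono θ hθ
      rw [op_comp, W.map_comp, U.map_comp, Category.assoc,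
        hψ₂ _ k hk e (i ≫ a) d hd (Category.assoc _ _ _).symm, ← reassoc_of% hψ₁ a k hk i]

/-! ### Existence of morphisms and of homotopies -/

open SimplexCategory (threshold δ_comp_threshold σ_comp_threshold)

theorem Splitting.nonempty_hom {W U : SimplicialObject C} (s : Splitting W)
    (hfill : ∀ n : ℕ, HasFillers (W _⦋n⦌) U) : Nonempty (W ⟶ U) := by
  -- A morphism `W ⟶ U` is a morphism on the product of `W` with a point; nothing is prescribed.
  obtain ⟨φ, hφ, -⟩ := s.exists_extension hfill ⦋0⦌ (fun _ => False) (fun _ _ h => h)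
    (fun _ h => h.elim) (fun _ _ h => h.elim)
  refine ⟨{ app Δ := φ Δ.unop.len (SimplexCategory.isTerminalZero.from _)
            naturality Δ Δ' θ := ?_ }⟩
  rw [← SimplexCategory.isTerminalZero.hom_ext
    (θ.unop ≫ SimplexCategory.isTerminalZero.from Δ.unop) (SimplexCategory.isTerminalZero.from _)]
  exact hφ Δ'.unop.len Δ.unop.len θ.unop _

/-- The simplicial homotopy attached to a morphism `φ` to `U` from the cylinder, the product of `W`
with `Δ[1]`, which restricts to `f` over the vertex `0` and to `g` over the vertex `1`. Its `i`-th
component is the restriction of `φ` to the `i`-th simplex of dimension `n + 1` of the prism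
`Δ[n] × Δ[1]`, namely the pair consisting of `σ i` and of the map `⦋n + 1⦌ ⟶ ⦋1⦌` with value `0`
exactly on `0, …, i`. -/
def homotopyOfCylinder {W U : SimplicialObject C} {f g : W ⟶ U}
    (φ : ∀ n : ℕ, (⦋n⦌ ⟶ ⦋1⦌) → (W _⦋n⦌ ⟶ U _⦋n⦌))
    (hφ : ∀ (m n : ℕ) (θ : ⦋m⦌ ⟶ ⦋n⦌) (a : ⦋n⦌ ⟶ ⦋1⦌),
      W.map θ.op ≫ φ m (θ ≫ a) = φ n a ≫ U.map θ.op)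
    (hf : ∀ n, φ n (threshold n (n + 1)) = f.app (op ⦋n⦌))
    (hg : ∀ n, φ n (threshold n 0) = g.app (op ⦋n⦌)) : Homotopy f g :=
  have hδ {n : ℕ} (i : Fin (n + 2)) (k l : ℕ) (h : i.val < k ∧ k = l + 1 ∨ k ≤ i.val ∧ k = l) :
      φ (n + 1) (threshold (n + 1) k) ≫ U.δ i = W.δ i ≫ φ n (threshold n l) := by
    rw [← δ_comp_threshold i h]
    exact (hφ n (n + 1) (SimplexCategory.δ i) _).symm
  have hσ {n : ℕ} (i : Fin (n + 1)) (k l : ℕ) (h : i.val < k ∧ l = k + 1 ∨ k ≤ i.val ∧ k = l) :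
      φ n (threshold n k) ≫ U.σ i = W.σ i ≫ φ (n + 1) (threshold (n + 1) l) := by
    rw [← σ_comp_threshold i h]
    exact (hφ (n + 1) n (SimplexCategory.σ i) _).symm
  { h {n} i := W.σ i ≫ φ (n + 1) (threshold (n + 1) (i.val + 1))
    h_zero_comp_δ_zero n := by
      have := W.δ_comp_σ_self (n := n) (i := 0)
      dsimp at this
      rw [Category.assoc, hδ 0 _ 0 (by simp), reassoc_of% this, hg]
    h_last_comp_δ_last n := by
      have := W.δ_comp_σ_succ (i := Fin.last n)
      dsimp at this
      rw [Category.assoc, hδ (Fin.last (n + 1)) _ (n + 1) (by simp), reassoc_of% this, hf]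
    h_succ_comp_δ_castSucc_of_lt {n} i j hij := by
      rw [Category.assoc, hδ i.castSucc _ (j.val + 1)
        (by simp [Fin.le_def] at hij ⊢; lia),
        ← Category.assoc, W.δ_comp_σ_of_le hij, Category.assoc]
    h_succ_comp_δ_castSucc_succ {n} j := by
      have h₁ := W.δ_comp_σ_self (i := j.succ)
      have h₂ := W.δ_comp_σ_succ (i := j.castSucc)
      dsimp at h₁ h₂
      rw [Category.assoc, Category.assoc, hδ j.castSucc.succ _ (j.val + 1) (by simp),
        hδ j.castSucc.succ _ (j.val + 1) (by simp), reassoc_of% h₂, reassoc_of% h₁]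
    h_castSucc_comp_δ_succ_of_lt {n} i j hji := by
      rw [Category.assoc, hδ i.succ _ (j.val + 1)
        (by simp [Fin.lt_def] at hji ⊢; lia),
        ← Category.assoc, W.δ_comp_σ_of_gt hji, Category.assoc]
    h_comp_σ_castSucc_of_le {n} i j hij := by
      rw [Category.assoc, hσ i.castSucc _ (j.val + 2)
        (by have : i.val ≤ j.val := hij
            rw [Fin.val_castSucc]; lia), ← Category.assoc, W.σ_comp_σ hij, Category.assoc]
      rfl
    h_comp_σ_succ_of_lt {n} i j hji := by
      rw [Category.assoc, hσ i.succ _ (j.val + 1)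
        (by have : j.val ≤ i.val := hji
            rw [Fin.val_succ]; lia), ← Category.assoc, ← W.σ_comp_σ hji, Category.assoc]
      rfl }

theorem Splitting.nonempty_homotopy {W U : SimplicialObject C} (s : Splitting W)
    (hfill : ∀ n : ℕ, HasFillers (W _⦋n⦌) U) (f g : W ⟶ U) : Nonempty (Homotopy f g) := by
  -- The subset of `Δ[1]` consisting of the constant simplices is its boundary.
  obtain ⟨φ, hφ, hφB⟩ := s.exists_extension hfill ⦋1⦌
    (fun {n} a => ∀ i : Fin (n + 1), a.toOrderHom i = a.toOrderHom 0)
    (fun θ a ha i => (ha _).trans (ha _).symm)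
    (fun {n} a _ => if a.toOrderHom 0 = 0 then f.app (op ⦋n⦌) else g.app (op ⦋n⦌))
    (fun {m n} θ a ha => by
      have : (θ ≫ a).toOrderHom 0 = a.toOrderHom 0 := ha _
      rw [this]
      split_ifs
      · exact f.naturality _
      · exact g.naturality _)
  refine ⟨homotopyOfCylinder φ hφ (fun n => ?_) (fun n => ?_)⟩
  · rw [hφB _ _ fun i => by simp [SimplexCategory.threshold_apply, i.is_le]]
    exact if_pos rfl
  · rw [hφB _ _ fun i => by simp [SimplexCategory.threshold_apply]]
    exact if_neg (by simp [SimplexCategory.threshold_apply])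

end CategoryTheory.SimplicialObject

/-! ### Weakly contractible objects of the pro-étale site -/

namespace ProetHypercovering

variable {S : Scheme.{u}}

/-- The pro-étale topology is subcanonical, and a covering `p` induces a locally surjective morphism
between the representable sheaves. Its surjectivity on sections over `T` is the assertion. -/
theorem IsWeaklyContractible.exists_lift {T X Y : S.ProEt} (hT : IsWeaklyContractible T)
    {p : X ⟶ Y} (hp : IsCovering p) (y : T ⟶ Y) : ∃ z : T ⟶ X, z ≫ p = y := by
  refine hT _ _ ((Scheme.ProEt.topology S).yoneda.map p) ⟨fun {Z} q => ?_⟩ y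
  refine (Scheme.ProEt.topology S).superset_covering ?_ ((Scheme.ProEt.topology S).pullback_stable q
    (Precoverage.generate_mem_toGrothendieck hp))
  rintro V v ⟨_, w, _, ⟨⟩, h⟩
  exact ⟨w, h⟩

theorem IsWeaklyContractible.hasFillers {T : S.ProEt} (hT : IsWeaklyContractible T)
    {U : SimplicialObject S.ProEt} (hU : IsHypercovering U) : SimplicialObject.HasFillers T U :=
  SimplicialObject.hasFillers_of_lifts T U
    (let ⟨z, _⟩ := hT.exists_lift hU.zero (toBase T); ⟨z⟩)
    fun n y => hT.exists_lift (hU.succ n) y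

end ProetHypercovering

theorem mainTheorem2 (S : Scheme.{u}) [CompactSpace S]
    (W U : SimplicialObject S.ProEt)
    (hW : ProetHypercovering.IsHypercovering W)
    (hWsplit : ProetHypercovering.IsSplit W)
    (hWaff : ProetHypercovering.IsAffineSimplicial W)
    (hWwc : ProetHypercovering.IsWeaklyContractibleSimplicial W)
    (hU : ProetHypercovering.IsHypercovering U) :
    Nonempty (W ⟶ U) ∧ ∀ f g : W ⟶ U, ProetHypercovering.Homotopic f g := by
  obtain ⟨s⟩ := hWsplit
  have hfill (n : ℕ) : SimplicialObject.HasFillers (W _⦋n⦌) U := (hWwc n).hasFillers hU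
  exact ⟨s.nonempty_hom hfill, s.nonempty_homotopy hfill⟩
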